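/- Let $g:\mathbb{R}^n\times\mathbb{R}^m\to\mathbb{R}$ and $G=(g_1,\dots,g_s):\mathbb{R}^n\times\mathbb{R}^m\to\mathbb{R}^s$ be $C^2$, with $g(x,\cdot)$ and every $g_i(x,\cdot)$ convex for all $x\in\mathbb{R}^n$, and let $h:\mathbb{R}^s\to[-\infty,\infty]$ be proper (finite somewhere and nowhere $-\infty$), epi-polyhedral (its epigraph is a polyhedral set) and nondecreasing (for the componentwise order). Consider the lower-level problem of minimizing $g(x,y)+h(G(x,y))$ over $y\in\mathbb{R}^m$, with Lagrangian $L(x,y,p)=g(x,y)+\langle G(x,y),p\rangle-h^*(p)$, where $h^*$ is the conjugate of $h$, and with primal-dual solution mapping $$S(x)=\Big\{(y,p)\in\mathbb{R}^m\times\mathbb{R}^s ~\Big|~ 0=-\nabla_y g(x,y)-\nabla_yG(x,y)^\top p,\quad 0\in -G(x,y)+\partial h^*(p)\Big\}.$$ For a set $C$ in a Euclidean space and $\bar c\in C$, the tangent cone $T_C(\bar c)$ consists of all limits of $(c^\nu-\bar c)/\tau^\nu$ with $c^\nu\in C$ and $\tau^\nu\searrow 0$; $\widehat N_C(\bar c)$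 is the polar cone of $T_C(\bar c)$; and the normal cone $N_C(\bar c)$ consists of all limits of $u^\nu\in\widehat N_C(c^\nu)$ with $c^\nu\in C$, $c^\nu\to\bar c$. Where $\varphi$ is finite, $\partial\varphi(z)=\{u\mid (u,-1)\in N_{\mathrm{epi}\,\varphi}(z,\varphi(z))\}$ and, for $\varphi$ lower semicontinuous, $\partial^\infty \varphi(z)=\{u\mid (u,0)\in N_{\mathrm{epi}\,\varphi}(z,\varphi(z))\}$. For $\bar u\in\partial h(\bar z)$, write $z\in D^*(\partial h)(\bar z,\bar u)(v)$ if $(z,-v)\in N_{\mathrm{gph}\,\partial h}(\bar z,\bar u)$. Let $x\in\mathbb{R}^n$ and $(y,p)\in S(x)$. Suppose that the basic qualification holds at $y$ for $x$, that is, $$u\in\partial^\infty h(G(x,y))\ \text{ and }\ \nabla_yG(x,y)^\top u=0\quad\Longrightarrow\quad u=0,$$ and that the following second-order condition (SOSC) holds for all $w\in\mathbb{R}^m$, $z\in\mathbb{R}^s$: $$-\nabla_yG(x,y)^\top z=\nabla_{yy}^2L(x,y,p)\,w\ \text{ and }\ z\in D^*(\partial h)(G(x,y),p)\big(\nabla_yG(x,y)w\big)\quad\Longrightarrow\quad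 w=0,\ z=0.$$ Then $S$ is single-valued in a neighborhood of $x$: for all $x'$ sufficiently close to $x$, the set $S(x')$ consists of exactly one point. (No relative interior condition is assumed.) -/

import Mathlib

open Set Filter Topology

noncomputable section

namespace ExtendedNLP

/-! ### Tangent and normal cones of a subset of a (finite-dimensional) Euclidean space -/

section Cones

variable {H : Type*} [NormedAddCommGroup H] [InnerProductSpace ℝ H]

/-- The (Bouligand) tangent cone to `C` at `x`: limits of `(xs ν - x) / τ ν` with `xs ν ∈ C` and
`τ ν ↘ 0`. -/
def tangentCone (C : Set H) (x : H) : Set H :=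
  {w | ∃ (xs : ℕ → H) (τ : ℕ → ℝ), (∀ ν, xs ν ∈ C) ∧ (∀ ν, 0 < τ ν) ∧
    Tendsto τ atTop (𝓝 0) ∧ Tendsto (fun ν => (τ ν)⁻¹ • (xs ν - x)) atTop (𝓝 w)}

/-- The regular normal cone: the polar of the tangent cone. -/
def regularNormalCone (C : Set H) (x : H) : Set H :=
  {u | ∀ w ∈ tangentCone C x, inner ℝ w u ≤ 0}

/-- The (limiting) normal cone to `C` at `x ∈ C`; it is empty when `x ∉ C`. -/
def normalCone (C : Set H) (x : H) : Set H :=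
  {u | x ∈ C ∧ ∃ xs us : ℕ → H, (∀ ν, xs ν ∈ C) ∧ (∀ ν, us ν ∈ regularNormalCone C (xs ν)) ∧
    Tendsto xs atTop (𝓝 x) ∧ Tendsto us atTop (𝓝 u)}

/-- A polyhedral set: a finite intersection of closed half-spaces (possibly the whole space). -/
def IsPolyhedral (C : Set H) : Prop :=
  ∃ (k : ℕ) (a : Fin k → H) (b : Fin k → ℝ), C = {x | ∀ i, inner ℝ (a i) x ≤ b i}

end Cones

/-! ### Extended-real-valued functions and their subgradients -/

section Functions

variable {E : Type*} [NormedAddCommGroup E] [InnerProductSpace ℝ E]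

/-- The epigraph of `f`, a subset of `E × ℝ` with its Euclidean (`ℓ²`) structure. -/
def epi (f : E → EReal) : Set (WithLp 2 (E × ℝ)) :=
  {q | f q.fst ≤ (q.snd : EReal)}

/-- `f` is proper: finite somewhere and nowhere `-∞`. -/
def Proper (f : E → EReal) : Prop :=
  (∃ x, f x < ⊤) ∧ ∀ x, f x ≠ ⊥

/-- `f` is epi-polyhedral: its epigraph is a polyhedral set. -/
def EpiPolyhedral (f : E → EReal) : Prop :=
  IsPolyhedral (epi f)

/-- The subdifferential of `f` at `x`: the `u` with `(u, -1)` normal to the epigraph at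
`(x, f x)`; it is empty where `f x` is not finite. -/
def subdiff (f : E → EReal) (x : E) : Set E :=
  {u | ∃ r : ℝ, f x = (r : EReal) ∧
    WithLp.toLp 2 (u, (-1 : ℝ)) ∈ normalCone (epi f) (WithLp.toLp 2 (x, r))}

/-- The horizon subdifferential of (an lsc function) `f` at `x`: the `u` with `(u, 0)` normal to
the epigraph at `(x, f x)`; it is empty where `f x` is not finite. -/
def horizonSubdiff (f : E → EReal) (x : E) : Set E :=
  {u | ∃ r : ℝ, f x = (r : EReal) ∧
    WithLp.toLp 2 (u, (0 : ℝ)) ∈ normalCone (epi f) (WithLp.toLp 2 (x, r))}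

/-- The conjugate function `f*(p) = sup_z ⟨z, p⟩ - f z`. -/
def conjugate (f : E → EReal) (p : E) : EReal :=
  ⨆ z : E, ((inner ℝ z p : ℝ) : EReal) - f z

/-- The graph of a set-valued mapping. -/
def gph {F : Type*} (Φ : E → Set F) : Set (WithLp 2 (E × F)) :=
  {q | q.snd ∈ Φ q.fst}

/-- The coderivative of a set-valued mapping `Φ` at `x` for `u ∈ Φ x`: `z ∈ D*Φ(x, u)(w)` iff
`(z, -w)` is normal to the graph of `Φ` at `(x, u)`. -/
def coderiv {F : Type*} [NormedAddCommGroup F] [InnerProductSpace ℝ F]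
    (Φ : E → Set F) (x : E) (u : F) (w : F) : Set E :=
  {z | WithLp.toLp 2 (z, -w) ∈ normalCone (gph Φ) (WithLp.toLp 2 (x, u))}

end Functions

/-! ### The lower-level problem: minimize `g x y + h (G x y)` over `y` -/

section LowerLevel

variable {n m s : ℕ}

/-- `h` on `ℝˢ` is nondecreasing for the componentwise order. -/
def Nondecreasing (h : EuclideanSpace ℝ (Fin s) → EReal) : Prop :=
  ∀ z z' : EuclideanSpace ℝ (Fin s), (∀ i, z i ≤ z' i) → h z ≤ h z'

variable
  (g : EuclideanSpace ℝ (Fin n) → EuclideanSpace ℝ (Fin m) → ℝ)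
  (h : EuclideanSpace ℝ (Fin s) → EReal)
  (G : EuclideanSpace ℝ (Fin n) → EuclideanSpace ℝ (Fin m) → EuclideanSpace ℝ (Fin s))

/-- `∇_y G(x, y)`, as a linear map `ℝᵐ → ℝˢ`. -/
def jacY (x : EuclideanSpace ℝ (Fin n)) (y : EuclideanSpace ℝ (Fin m)) :
    EuclideanSpace ℝ (Fin m) →L[ℝ] EuclideanSpace ℝ (Fin s) :=
  fderiv ℝ (G x) y

/-- `∇_y G(x, y)ᵀ`, as a linear map `ℝˢ → ℝᵐ`. -/
def jacYT (x : EuclideanSpace ℝ (Fin n)) (y : EuclideanSpace ℝ (Fin m)) :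
    EuclideanSpace ℝ (Fin s) →L[ℝ] EuclideanSpace ℝ (Fin m) :=
  ContinuousLinearMap.adjoint (jacY G x y)

/-- The Lagrangian `L(x, y, p) = g(x, y) + ⟨G(x, y), p⟩ - h*(p)`. -/
def lagrangian (x : EuclideanSpace ℝ (Fin n)) (y : EuclideanSpace ℝ (Fin m))
    (p : EuclideanSpace ℝ (Fin s)) : EReal :=
  ((g x y + inner ℝ (G x y) p : ℝ) : EReal) - conjugate h p

/-- The Hessian `∇²_yy L(x, y, p)`, as a linear map `ℝᵐ → ℝᵐ`; it is only used at `p` with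
`h*(p)` finite, where `L(x, ·, p)` is real-valued. -/
def hessLagrangian (x : EuclideanSpace ℝ (Fin n)) (y : EuclideanSpace ℝ (Fin m))
    (p : EuclideanSpace ℝ (Fin s)) :
    EuclideanSpace ℝ (Fin m) →L[ℝ] EuclideanSpace ℝ (Fin m) :=
  fderiv ℝ (gradient fun y' => (lagrangian g h G x y' p).toReal) y

/-- The primal-dual solution mapping of the lower-level problem:
`(y, p) ∈ S(x)` iff `0 = -∇_y g(x, y) - ∇_y G(x, y)ᵀ p` and `0 ∈ -G(x, y) + ∂h*(p)`. -/
def S (x : EuclideanSpace ℝ (Fin n)) :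
    Set (EuclideanSpace ℝ (Fin m) × EuclideanSpace ℝ (Fin s)) :=
  {q | 0 = -gradient (g x) q.1 - jacYT G x q.1 q.2 ∧ G x q.1 ∈ subdiff (conjugate h) q.2}

/-- The basic qualification at `y` for `x`. -/
def BasicQualification (x : EuclideanSpace ℝ (Fin n)) (y : EuclideanSpace ℝ (Fin m)) : Prop :=
  ∀ u ∈ horizonSubdiff h (G x y), jacYT G x y u = 0 → u = 0

/-- The coderivative-based second-order condition at `y` for `x` and `p`. -/
def SOSC (x : EuclideanSpace ℝ (Fin n)) (y : EuclideanSpace ℝ (Fin m))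
    (p : EuclideanSpace ℝ (Fin s)) : Prop :=
  ∀ (w : EuclideanSpace ℝ (Fin m)) (z : EuclideanSpace ℝ (Fin s)),
    -jacYT G x y z = hessLagrangian g h G x y p w →
    z ∈ coderiv (subdiff h) (G x y) p (jacY G x y w) →
    w = 0 ∧ z = 0

end LowerLevel

end ExtendedNLP

end

/-! Since `h` is nondecreasing, `h*` is finite only at `p ≥ 0`. The Lagrangian is therefore convex
in `y` and concave in `p`, and `S(x')` is its set of saddle points. To work with a continuous real
function, `h*(p)` is replaced by a variable `r` with `(p, r)` in the epigraph of `h*`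
(`mem_S_iff_exists_mem_saddleSet`).

Local uniqueness. Saddle points can be recombined: from `(y₁, p₁)` and `(y₂, p₂)` one also gets
`(y₂, p₁)` and `(y₁, p₂)`, so it suffices to vary one component at a time. By polyhedrality,
`∂h*(p') ⊆ ∂h*(p)` for `p'` near `p`, and graph points `(z', p')` of `∂h` near `(G(x, y), p)` have
`p' ∈ ∂h(G(x, y))`. Hence differences of `G`-values lie in `V`, the direction space of `∂h*(p)`, and
differences of multipliers lie in `W`, that of `∂h(G(x, y))`. Since `{0} × V` and `W × {0}` consist
of normals to `gph ∂h`, SOSC with `z = 0` or `w = 0` makes the Hessian injective on `{w | ∇_y G w ∈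
V}` and `∇_y Gᵀ` injective on `W`. Strict differentiability turns this into uniqueness in a
neighborhood uniform in `x'`.

Existence and globalization (`eventually_saddleSet_eq_singleton`). Sion's theorem gives saddle
points on compact balls for every `x'`; by compactness they approach the unique one at `x`, so they
are interior to the balls and hence global. Convexity of the saddle set upgrades local to global
uniqueness. -/

noncomputable section

namespace ExtendedNLP

/-! ### Convex-concave saddle points: stability from local uniqueness -/

section Saddle

/-- The saddle points in `X × Y` of `f`, to be minimized over `X` and maximized over `Y`. -/
def saddleSet {E F : Type*} (X : Set E) (Y : Set F) (f : E → F → ℝ) : Set (E × F) :=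
  {q | q.1 ∈ X ∧ q.2 ∈ Y ∧ IsSaddlePointOn X Y f q.1 q.2}

variable {E F : Type*} [NormedAddCommGroup E] [NormedSpace ℝ E]
  [NormedAddCommGroup F] [NormedSpace ℝ F]

theorem convex_saddleSet {X : Set E} {Y : Set F} {f : E → F → ℝ}
    (hX : ∀ b ∈ Y, ConvexOn ℝ X fun a => f a b) (hY : ∀ a ∈ X, ConcaveOn ℝ Y (f a)) :
    Convex ℝ (saddleSet X Y f) := by
  rintro ⟨a, b⟩ ⟨ha, hb, hab⟩ ⟨a', b'⟩ ⟨ha', hb', hab'⟩ s t hs ht hst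
  dsimp only at ha hb ha' hb' hab hab'
  -- The mixed pairs `(a, b')` and `(a', b)` are saddle points too, so `f a v` and `f a' v` are both
  -- below each of `f u b` and `f u b'`.
  have h12 := hab.swap_left ha' hb hab'
  have h21 := hab'.swap_left ha hb' hab
  have hbt : s • b + t • b' ∈ Y := (hY a ha).1 hb hb' hs ht hst
  refine ⟨(hX b hb).1 ha ha' hs ht hst, hbt, ?_⟩
  intro u hu v hv
  have h1 : f (s • a + t • a') v ≤ s • f a v + t • f a' v := (hX v hv).2 ha ha' hs ht hst
  have h2 : s • f u b + t • f u b' ≤ f u (s • b + t • b') := (hY u hu).2 hb hb' hs ht hst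
  have hle : ∀ w, f a v ≤ w → f a' v ≤ w → f (s • a + t • a') v ≤ w := by
    intro w h3 h4
    calc _ ≤ _ := h1
      _ ≤ s • w + t • w := by simp only [smul_eq_mul]; gcongr
      _ = w := by simp only [smul_eq_mul, ← add_mul, hst, one_mul]
  have h3 := hle _ (hab u hu v hv) (h21 u hu v hv)
  have h4 := hle _ (h12 u hu v hv) (hab' u hu v hv)
  calc f (s • a + t • a') v = s • f (s • a + t • a') v + t • f (s • a + t • a') v := by
        simp only [smul_eq_mul, ← add_mul, hst, one_mul]
    _ ≤ s • f u b + t • f u b' := by simp only [smul_eq_mul]; gcongr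
    _ ≤ _ := h2

/-- A saddle point relative to balls, interior to them, is a saddle point. -/
theorem mem_saddleSet_of_mem_ball {K : Set F} {f : E → F → ℝ}
    (hX : ∀ b ∈ K, ConvexOn ℝ univ fun a => f a b) (hY : ∀ a, ConcaveOn ℝ K (f a))
    {c q : E × F} {r : ℝ}
    (h : q ∈ saddleSet (Metric.closedBall c.1 r) (K ∩ Metric.closedBall c.2 r) f)
    (hq : q ∈ Metric.ball c r) : q ∈ saddleSet univ K f := by
  obtain ⟨a, b⟩ := q
  obtain ⟨h1, h2, h3⟩ := h
  rw [← ball_prod_same] at hq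
  obtain ⟨hqa, hqb⟩ := hq
  dsimp only at h1 h2 h3 hqa hqb
  have hmin : ∀ u, f a b ≤ f u b := by
    refine IsMinOn.of_isLocalMin_of_convex_univ (f := fun u => f u b) ?_ (hX b h2.1)
    filter_upwards [Metric.isOpen_ball.mem_nhds hqa] with u hu
    exact h3 u (Metric.ball_subset_closedBall hu) b h2
  have hmax : IsMaxOn (f a) K b := by
    refine IsMaxOn.of_isLocalMaxOn_of_concaveOn h2.1 ?_ (hY a)
    filter_upwards [mem_nhdsWithin_of_mem_nhds (Metric.isOpen_ball.mem_nhds hqb),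
      self_mem_nhdsWithin] with v hv hvK
    exact h3 a h1 v ⟨hvK, Metric.ball_subset_closedBall hv⟩
  exact ⟨mem_univ _, h2.1, fun u _ v hv => (hmax hv).trans (hmin u)⟩

/-- A second point `q'` would give points of the segment from `q` to `q'` that lie in the ball and
differ from `q`. -/
theorem eq_of_convex_of_inter_ball_subsingleton {V : Type*} [NormedAddCommGroup V]
    [NormedSpace ℝ V] {C : Set V} (hC : Convex ℝ C) {c q q' : V} {ε : ℝ}
    (hq : q ∈ C) (hq' : q' ∈ C) (hqc : q ∈ Metric.ball c ε)
    (huniq : ∀ v ∈ C ∩ Metric.ball c ε, v = q) : q' = q := by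
  have hcont : ContinuousAt (fun t : ℝ => AffineMap.lineMap q q' t) 0 := by
    simp only [AffineMap.lineMap_apply]
    fun_prop
  have hev : ∀ᶠ t in 𝓝[>] (0 : ℝ), AffineMap.lineMap q q' t ∈ Metric.ball c ε := by
    refine nhdsWithin_le_nhds (hcont.eventually (Metric.isOpen_ball.mem_nhds ?_))
    simpa using hqc
  obtain ⟨t, ht, ht0, ht1⟩ := (hev.and (Ioo_mem_nhdsGT (zero_lt_one' ℝ))).exists
  have hmem : AffineMap.lineMap q q' t ∈ C := hC.lineMap_mem hq hq' ⟨ht0.le, ht1.le⟩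
  have := huniq _ ⟨hmem, ht⟩
  rw [AffineMap.lineMap_apply] at this
  simpa [ht0.ne', sub_eq_zero] using this

/-- A convex-concave saddle point problem that depends continuously on a parameter and whose
saddle points are locally unique has exactly one saddle point for parameters close to the given
one. -/
theorem eventually_saddleSet_eq_singleton {X : Type*} [TopologicalSpace X]
    [FiniteDimensional ℝ E] [FiniteDimensional ℝ F]
    {K : Set F} (hKc : IsClosed K) (hK : Convex ℝ K) {f : X → E → F → ℝ}
    (hf : Continuous fun q : X × E × F => f q.1 q.2.1 q.2.2)
    (hfX : ∀ x, ∀ b ∈ K, ConvexOn ℝ univ fun a => f x a b)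
    (hfY : ∀ x a, ConcaveOn ℝ K (f x a))
    {x : X} {c : E × F} (hc : c ∈ saddleSet univ K (f x))
    {ε : ℝ} (hε : 0 < ε)
    (huniq : ∀ᶠ x' in 𝓝 x, ∀ q ∈ saddleSet univ K (f x') ∩ Metric.ball c ε,
      ∀ q' ∈ saddleSet univ K (f x') ∩ Metric.ball c ε, q = q') :
    ∀ᶠ x' in 𝓝 x, ∃ q, saddleSet univ K (f x') = {q} := by
  have := FiniteDimensional.proper_real E
  have := FiniteDimensional.proper_real F
  set B := Metric.closedBall c.1 1 with hB
  set C := K ∩ Metric.closedBall c.2 1 with hC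
  have hBconv : Convex ℝ B := convex_closedBall _ _
  have hCconv : Convex ℝ C := hK.inter (convex_closedBall _ _)
  have hBcomp : IsCompact B := isCompact_closedBall _ _
  have hCcomp : IsCompact C := (isCompact_closedBall _ _).inter_left hKc
  have hcB : c.1 ∈ B := Metric.mem_closedBall_self zero_le_one
  have hcC : c.2 ∈ C := ⟨hc.2.1, Metric.mem_closedBall_self zero_le_one⟩
  have hfB : ∀ x, ∀ b ∈ C, ConvexOn ℝ B fun a => f x a b := fun x b hb =>
    (hfX x b hb.1).subset (subset_univ _) hBconv
  have hfC : ∀ x, ∀ a ∈ B, ConcaveOn ℝ C (f x a) := fun x a _ =>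
    (hfY x a).subset inter_subset_left hCconv
  have hexists : ∀ x', (saddleSet B C (f x')).Nonempty := by
    intro x'
    have hca : ∀ b, Continuous fun a => f x' a b := fun b =>
      hf.comp (by fun_prop : Continuous fun a : E => (x', a, b))
    have hcb : ∀ a, Continuous fun b => f x' a b := fun a =>
      hf.comp (by fun_prop : Continuous fun b : F => (x', a, b))
    obtain ⟨a, ha, b, hb, hab⟩ := Sion.exists_isSaddlePointOn (f := f x') ⟨_, hcB⟩ hBconv hBcomp
      (fun b _ => (hca b).lowerSemicontinuous.lowerSemicontinuousOn _)
      (fun b hb => (hfB x' b hb).quasiconvexOn) hCconv ⟨_, hcC⟩ hCcomp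
      (fun a _ => (hcb a).upperSemicontinuous.upperSemicontinuousOn _)
      (fun a ha => (hfC x' a ha).quasiconcaveOn)
    exact ⟨(a, b), ha, hb, hab⟩
  set δ := min ε 1 with hδ
  have hδ0 : 0 < δ := lt_min hε one_pos
  have hcδ : c ∈ Metric.ball c δ := Metric.mem_ball_self hδ0
  have hglobal : ∀ x', ∀ q ∈ saddleSet B C (f x'), q ∈ Metric.ball c δ →
      q ∈ saddleSet univ K (f x') := fun x' q hq hqδ =>
    mem_saddleSet_of_mem_ball (hfX x') (hfY x') hq
      (Metric.ball_subset_ball (min_le_right _ _) hqδ)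
  have hδε : Metric.ball c δ ⊆ Metric.ball c ε := Metric.ball_subset_ball (min_le_left _ _)
  have hcloc : c ∈ saddleSet B C (f x) :=
    ⟨hcB, hcC, fun u _ v hv => hc.2.2 u (mem_univ _) v hv.1⟩
  -- At the reference parameter the truncated problem has only the saddle point `c`: near `c` its
  -- saddle points are global, and its saddle set is convex.
  have hx0 : ∀ q ∈ saddleSet B C (f x), q = c := fun q hq =>
    eq_of_convex_of_inter_ball_subsingleton (convex_saddleSet (hfB x) (hfC x)) hcloc hq hcδ
      fun v hv => huniq.self_of_nhds _ ⟨hglobal x v hv.1 hv.2, hδε hv.2⟩ _ ⟨hc, hδε hcδ⟩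
  -- Failing to be a saddle point is witnessed by a strict inequality, an open condition in
  -- parameter and point; compactness makes it uniform away from `c`.
  have hnear : ∀ᶠ x' in 𝓝 x, ∀ q ∈ (B ×ˢ C) \ Metric.ball c δ, q ∉ saddleSet B C (f x') := by
    refine ((hBcomp.prod hCcomp).diff Metric.isOpen_ball).eventually_forall_of_forall_eventually
      fun q hq => ?_
    have hne : ¬ IsSaddlePointOn B C (f x) q.1 q.2 := by
      intro hs
      have := hx0 q ⟨hq.1.1, hq.1.2, hs⟩
      exact hq.2 (this ▸ hcδ)
    simp only [IsSaddlePointOn, not_forall, not_le] at hne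
    obtain ⟨u, hu, v, hv, huv⟩ := hne
    have h1 : Continuous fun z : X × E × F => f z.1 u z.2.2 :=
      hf.comp (by fun_prop : Continuous fun z : X × E × F => (z.1, u, z.2.2))
    have h2 : Continuous fun z : X × E × F => f z.1 z.2.1 v :=
      hf.comp (by fun_prop : Continuous fun z : X × E × F => (z.1, z.2.1, v))
    filter_upwards [(isOpen_lt h1 h2).mem_nhds (show (x, q) ∈ _ from huv)] with z hz hzs
    exact absurd (hzs.2.2 u hu v hv) (not_le.2 hz)
  filter_upwards [hnear, huniq] with x' hx' hu
  obtain ⟨q, hq⟩ := hexists x'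
  have hqδ : q ∈ Metric.ball c δ := by
    by_contra hcon
    exact hx' q ⟨⟨hq.1, hq.2.1⟩, hcon⟩ hq
  have hqs := hglobal x' q hq hqδ
  refine ⟨q, Set.eq_singleton_iff_unique_mem.2 ⟨hqs, fun q' hq' => ?_⟩⟩
  exact eq_of_convex_of_inter_ball_subsingleton
    (convex_saddleSet (hfX x') (fun a _ => hfY x' a)) hqs hq' hqδ
    fun v hv => hu _ ⟨hv.1, hδε hv.2⟩ _ ⟨hqs, hδε hqδ⟩

end Saddle

/-! ### Normal cones to convex and polyhedral sets -/

section ConvexCones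

variable {H : Type*} [NormedAddCommGroup H] [InnerProductSpace ℝ H]

theorem sub_mem_tangentCone {C : Set H} (hC : Convex ℝ C) {x c : H} (hx : x ∈ C) (hc : c ∈ C) :
    c - x ∈ tangentCone C x := by
  have hpos : ∀ ν : ℕ, (0 : ℝ) < 1 / ((ν : ℝ) + 1) := fun ν => by positivity
  refine ⟨fun ν => x + (1 / ((ν : ℝ) + 1)) • (c - x), fun ν => 1 / ((ν : ℝ) + 1), fun ν => ?_, hpos,
    tendsto_one_div_add_atTop_nhds_zero_nat, ?_⟩
  · refine hC.add_smul_sub_mem hx hc ⟨(hpos ν).le, ?_⟩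
    rw [div_le_one (by positivity)]
    simp
  · refine tendsto_const_nhds.congr fun ν => ?_
    rw [add_sub_cancel_left, inv_smul_smul₀ (hpos ν).ne']

theorem mem_regularNormalCone_of_forall_inner_le {C : Set H} {x u : H}
    (h : ∀ c ∈ C, inner ℝ (c - x) u ≤ 0) : u ∈ regularNormalCone C x := by
  rintro w ⟨xs, τ, hxs, hτ, -, hw⟩
  refine le_of_tendsto (hw.inner tendsto_const_nhds) (Eventually.of_forall fun ν => ?_)
  rw [real_inner_smul_left]
  exact mul_nonpos_of_nonneg_of_nonpos (inv_nonneg.2 (hτ ν).le) (h _ (hxs ν))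

/-- The normal cone to a convex set is the normal cone of convex analysis. -/
theorem mem_normalCone_iff_of_convex {C : Set H} (hC : Convex ℝ C) {x u : H} :
    u ∈ normalCone C x ↔ x ∈ C ∧ ∀ c ∈ C, inner ℝ (c - x) u ≤ 0 := by
  constructor
  · rintro ⟨hx, xs, us, hxs, hus, hxlim, hulim⟩
    refine ⟨hx, fun c hc => ?_⟩
    refine le_of_tendsto ((tendsto_const_nhds.sub hxlim).inner hulim)
      (Eventually.of_forall fun ν => ?_)
    exact hus ν _ (sub_mem_tangentCone hC (hxs ν) hc)
  · rintro ⟨hx, h⟩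
    exact ⟨hx, fun _ => x, fun _ => u, fun _ => hx,
      fun _ => mem_regularNormalCone_of_forall_inner_le h, tendsto_const_nhds, tendsto_const_nhds⟩

theorem IsPolyhedral.convex {C : Set H} (hC : IsPolyhedral C) : Convex ℝ C := by
  obtain ⟨k, a, b, rfl⟩ := hC
  rw [Set.ofPred_forall]
  exact convex_iInter fun i => convex_halfSpace_le (innerₗ H (a i)).isLinear (b i)

theorem IsPolyhedral.isClosed {C : Set H} (hC : IsPolyhedral C) : IsClosed C := by
  obtain ⟨k, a, b, rfl⟩ := hC
  rw [Set.ofPred_forall]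
  exact isClosed_iInter fun i => isClosed_le (by fun_prop) continuous_const

end ConvexCones

/-! ### Conjugation and inversion of subgradients -/

section Conjugate

theorem toLp_mem_epi {E : Type*} {f : E → EReal} {z : E} {t : ℝ} :
    WithLp.toLp 2 (z, t) ∈ epi f ↔ f z ≤ t := Iff.rfl

theorem Proper.exists_le_coe {E : Type*} {f : E → EReal} (hf : Proper f) : ∃ (z : E) (ρ : ℝ), f z ≤ ρ := by
  obtain ⟨z, hz⟩ := hf.1
  obtain ⟨ρ, hρ, -⟩ := EReal.lt_iff_exists_real_btwn.1 hz
  exact ⟨z, ρ, hρ.le⟩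

theorem eq_coe_of_le_coe {E : Type*} {f : E → EReal} (hf : ∀ x, f x ≠ ⊥) {z : E} {ρ : ℝ} (h : f z ≤ ρ) :
    ∃ r : ℝ, f z = r ∧ r ≤ ρ := by
  have hz : f z ≠ ⊤ := (h.trans_lt (EReal.coe_lt_top ρ)).ne
  refine ⟨(f z).toReal, (EReal.coe_toReal hz (hf z)).symm, ?_⟩
  rwa [← EReal.coe_le_coe_iff, EReal.coe_toReal hz (hf z)]

variable {E : Type*} [NormedAddCommGroup E] [InnerProductSpace ℝ E]

/-- Subgradients of a convex function in the sense of convex analysis. -/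
theorem mem_subdiff_iff {f : E → EReal} (hf : Convex ℝ (epi f)) {x u : E} :
    u ∈ subdiff f x ↔ ∃ r : ℝ, f x = r ∧ ∀ (z : E) (t : ℝ), f z ≤ t → inner ℝ (z - x) u ≤ t - r := by
  refine exists_congr fun r => and_congr_right fun hr => ?_
  rw [mem_normalCone_iff_of_convex hf]
  constructor
  · rintro ⟨-, h⟩ z t hzt
    have := h (WithLp.toLp 2 (z, t)) hzt
    simp [WithLp.prod_inner_apply] at this
    linarith
  · intro h
    refine ⟨hr.le, fun c hc => ?_⟩
    have := h c.fst c.snd hc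
    simp [WithLp.prod_inner_apply]
    linarith

theorem conjugate_le_iff {f : E → EReal} {p : E} {t : ℝ} :
    conjugate f p ≤ t ↔ ∀ (z : E) (ρ : ℝ), f z ≤ ρ → inner ℝ z p - ρ ≤ t := by
  rw [conjugate, iSup_le_iff]
  refine forall_congr' fun z => ?_
  induction hz : f z with
  | bot =>
    constructor
    · intro h
      simp at h
    · intro h
      have := h (inner ℝ z p - t - 1) bot_le
      linarith
  | top => simp
  | coe r =>
    constructor
    · intro h ρ hρ
      rw [EReal.coe_le_coe_iff] at hρ
      rw [← EReal.coe_sub, EReal.coe_le_coe_iff] at h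
      linarith
    · intro h
      rw [← EReal.coe_sub, EReal.coe_le_coe_iff]
      exact h r le_rfl

theorem convex_epi_conjugate (f : E → EReal) : Convex ℝ (epi (conjugate f)) := by
  intro P hP Q hQ a b ha hb hab
  rw [epi, mem_ofPred_eq, conjugate_le_iff] at *
  intro z ρ hz
  have h1 := mul_le_mul_of_nonneg_left (hP z ρ hz) ha
  have h2 := mul_le_mul_of_nonneg_left (hQ z ρ hz) hb
  simp only [WithLp.add_fst, WithLp.smul_fst, WithLp.add_snd, WithLp.smul_snd, inner_add_right,
    inner_smul_right, smul_eq_mul]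
  have : ρ = a * ρ + b * ρ := by rw [← add_mul, hab, one_mul]
  linarith

theorem Proper.conjugate_ne_bot {f : E → EReal} (hf : Proper f) (p : E) : conjugate f p ≠ ⊥ := by
  obtain ⟨z, ρ, hz⟩ := hf.exists_le_coe
  intro hbot
  have := conjugate_le_iff.1 (hbot ▸ bot_le : conjugate f p ≤ ((inner ℝ z p - ρ - 1 : ℝ) : EReal)) z ρ hz
  linarith

theorem mem_subdiff_conjugate_of_mem_subdiff {f : E → EReal} (hconv : Convex ℝ (epi f)) {z p : E}
    (h : p ∈ subdiff f z) : z ∈ subdiff (conjugate f) p := by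
  rw [mem_subdiff_iff hconv] at h
  obtain ⟨r, hr, h⟩ := h
  have hle : conjugate f p ≤ ((inner ℝ z p - r : ℝ) : EReal) := by
    refine conjugate_le_iff.2 fun z' ρ hz' => ?_
    have := h z' ρ hz'
    rw [inner_sub_left] at this
    linarith
  have hge : ((inner ℝ z p - r : ℝ) : EReal) ≤ conjugate f p := by
    rw [EReal.coe_sub, ← hr]
    exact le_iSup (fun z : E => ((inner ℝ z p : ℝ) : EReal) - f z) z
  rw [mem_subdiff_iff (convex_epi_conjugate f)]
  refine ⟨inner ℝ z p - r, le_antisymm hle hge, fun q t hq => ?_⟩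
  have := conjugate_le_iff.1 hq z r hr.le
  rw [inner_sub_left, real_inner_comm z q, real_inner_comm z p]
  linarith

/-- Inversion of the subgradients of a proper closed convex function by conjugation. -/
theorem mem_subdiff_of_mem_subdiff_conjugate [CompleteSpace E] {f : E → EReal} (hf : Proper f)
    (hconv : Convex ℝ (epi f)) (hcl : IsClosed (epi f)) {z p : E}
    (h : z ∈ subdiff (conjugate f) p) : p ∈ subdiff f z := by
  rw [mem_subdiff_iff (convex_epi_conjugate f)] at h
  obtain ⟨k, hk, h⟩ := h
  have hkle := conjugate_le_iff.1 hk.le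
  -- Equality in Fenchel–Young. Otherwise `(z, ⟨z, p⟩ - k)` is strictly separated from the epigraph,
  -- by a functional whose vertical component `β` is nonpositive.
  have hz : f z ≤ ((inner ℝ z p - k : ℝ) : EReal) := by
    rw [← toLp_mem_epi]
    by_contra hnot
    obtain ⟨φ, α, hφ, hα⟩ := geometric_hahn_banach_closed_point hconv hcl hnot
    set v := (InnerProductSpace.toDual ℝ (WithLp 2 (E × ℝ))).symm φ with hv
    have hφv : ∀ z' t, φ (WithLp.toLp 2 (z', t)) = inner ℝ z' v.fst + t * v.snd := by
      intro z' t
      rw [← InnerProductSpace.toDual_symm_apply (𝕜 := ℝ), ← hv, real_inner_comm,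
        WithLp.prod_inner_apply]
      simp [mul_comm]
    have hsep : ∀ z' t, f z' ≤ (t : ℝ) → inner ℝ z' v.fst + t * v.snd < α := by
      intro z' t hzt
      rw [← hφv]
      exact hφ _ hzt
    rw [hφv] at hα
    set β := v.snd with hβ
    have hβle : β ≤ 0 := by
      by_contra! hpos
      obtain ⟨z0, ρ, hz0⟩ := hf.exists_le_coe
      have h1 := hsep z0 (ρ + |α - inner ℝ z0 v.fst - ρ * β| / β)
        (hz0.trans (EReal.coe_le_coe_iff.2 (by simpa using by positivity)))
      rw [add_mul, div_mul_cancel₀ _ hpos.ne'] at h1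
      have := le_abs_self (α - inner ℝ z0 v.fst - ρ * β)
      linarith
    rcases hβle.eq_or_lt with h0 | hneg
    -- Vertical separation: moving `p` by `v.fst` raises the conjugate by at most `α`, so the
    -- subgradient inequality gives `⟨z, v.fst⟩ ≤ α`.
    · have h1 := h (p + v.fst) (k + α) (conjugate_le_iff.2 fun z' ρ hz' => by
        have h2 := hkle z' ρ hz'
        have h3 := hsep z' ρ hz'
        rw [h0] at h3
        rw [inner_add_right]
        linarith)
      rw [add_sub_cancel_left, real_inner_comm] at h1
      rw [h0] at hα
      linarith
    · have hb : 0 < (-β)⁻¹ := inv_pos.2 (neg_pos.2 hneg)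
      have hbβ : (-β)⁻¹ * β = -1 := by
        rw [inv_neg, neg_mul, inv_mul_cancel₀ hneg.ne]
      -- After normalizing `β` to `-1`, the separating hyperplane is an affine minorant of `f`,
      -- which bounds the conjugate at its slope.
      have h1 := h ((-β)⁻¹ • v.fst) ((-β)⁻¹ * α) (conjugate_le_iff.2 fun z' ρ hz' => by
        have h3 := mul_lt_mul_of_pos_left (hsep z' ρ hz') hb
        have : (-β)⁻¹ * (inner ℝ z' v.fst + ρ * β) = (-β)⁻¹ * inner ℝ z' v.fst - ρ := by
          linear_combination ρ * hbβ
        rw [inner_smul_right]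
        linarith)
      have h3 := mul_lt_mul_of_pos_left hα hb
      rw [inner_sub_left, inner_smul_left, real_inner_comm, real_inner_comm z p] at h1
      have : (-β)⁻¹ * (inner ℝ z v.fst + (inner ℝ z p - k) * β)
          = (-β)⁻¹ * inner ℝ z v.fst - (inner ℝ z p - k) := by
        linear_combination (inner ℝ z p - k) * hbβ
      simp only [conj_trivial] at h1
      linarith
  obtain ⟨r, hr, hrle⟩ := eq_coe_of_le_coe hf.2 hz
  have hge := hkle z r hr.le
  rw [mem_subdiff_iff hconv]
  refine ⟨r, hr, fun z' t hz' => ?_⟩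
  have := hkle z' t hz'
  rw [inner_sub_left]
  linarith

end Conjugate

/-! ### Local behaviour of normals to polyhedral sets -/

section PolyhedralSets

variable {H : Type*} [NormedAddCommGroup H] [InnerProductSpace ℝ H]

/-- Normals to a polyhedral set depend monotonically on the set of active constraints. -/
theorem forall_inner_sub_le_zero_of_active_subset {k : ℕ} {a : Fin k → H} {b : Fin k → ℝ}
    {x x' u : H} (hx' : ∀ i, inner ℝ (a i) x' ≤ b i)
    (hact : ∀ i, inner ℝ (a i) x' = b i → inner ℝ (a i) x = b i)
    (h : ∀ c, (∀ i, inner ℝ (a i) c ≤ b i) → inner ℝ (c - x') u ≤ 0)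
    {c : H} (hc : ∀ i, inner ℝ (a i) c ≤ b i) : inner ℝ (c - x) u ≤ 0 := by
  have hev : ∀ᶠ t in 𝓝[>] (0 : ℝ), ∀ i, inner ℝ (a i) (x' + t • (c - x)) ≤ b i := by
    refine eventually_all.2 fun i => ?_
    rcases (hx' i).eq_or_lt with heq | hlt
    · filter_upwards [self_mem_nhdsWithin] with t ht
      rw [inner_add_right, inner_smul_right, inner_sub_right, heq, hact i heq]
      have := mul_nonpos_of_nonneg_of_nonpos (le_of_lt ht) (sub_nonpos.2 (hc i))
      linarith
    · have hcont : ContinuousAt (fun t : ℝ => inner ℝ (a i) (x' + t • (c - x))) 0 := by fun_prop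
      have hlt' : inner ℝ (a i) (x' + (0 : ℝ) • (c - x)) < b i := by simpa using hlt
      filter_upwards [nhdsWithin_le_nhds (hcont.eventually (Iio_mem_nhds hlt'))] with t ht
      exact le_of_lt ht
  obtain ⟨t, ht, ht0⟩ := (hev.and self_mem_nhdsWithin).exists
  have := h _ ht
  rw [add_sub_cancel_left, real_inner_smul_left] at this
  exact nonpos_of_mul_nonpos_right this ht0

theorem IsPolyhedral.eventually_normalCone_subset {C : Set H} (hC : IsPolyhedral C) {x : H}
    (hx : x ∈ C) : ∀ᶠ x' in 𝓝 x, normalCone C x' ⊆ normalCone C x := by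
  have hconv := hC.convex
  obtain ⟨k, a, b, rfl⟩ := hC
  have hev : ∀ᶠ x' in 𝓝 x, ∀ i, inner ℝ (a i) x' = b i → inner ℝ (a i) x = b i := by
    refine eventually_all.2 fun i => ?_
    by_cases h : inner ℝ (a i) x = b i
    · exact Eventually.of_forall fun _ _ => h
    · have hcont : ContinuousAt (fun x' => inner ℝ (a i) x') x := by fun_prop
      filter_upwards [hcont.eventually_ne h] with x' hx' heq using absurd heq hx'
  filter_upwards [hev] with x' hx' u hu
  rw [mem_normalCone_iff_of_convex hconv] at hu ⊢
  exact ⟨hx, fun c hc => forall_inner_sub_le_zero_of_active_subset hu.1 hx' hu.2 hc⟩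

/-- A polyhedral set has finitely many normal cones, so a normal close to `u` can be
replaced by `u`. -/
theorem IsPolyhedral.eventually_mem_normalCone {C : Set H} (hC : IsPolyhedral C) (u : H) :
    ∀ᶠ u' in 𝓝 u, ∀ x, u' ∈ normalCone C x → u ∈ normalCone C x := by
  have hconv := hC.convex
  obtain ⟨k, a, b, rfl⟩ := hC
  set C := {x | ∀ i, inner ℝ (a i) x ≤ b i}
  -- `D J` collects the vectors normal at all points with active set exactly `J`; there are finitely
  -- many, each closed.
  let D : Set (Fin k) → Set H := fun J =>
    {v | ∀ x ∈ C, {i | inner ℝ (a i) x = b i} = J → ∀ c ∈ C, inner ℝ (c - x) v ≤ 0}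
  have hD : ∀ J, IsClosed (D J) := fun J => by
    simp only [D, Set.ofPred_forall]
    exact isClosed_iInter fun x => isClosed_iInter fun _ => isClosed_iInter fun _ =>
      isClosed_iInter fun c => isClosed_iInter fun _ => isClosed_le (by fun_prop) continuous_const
  have hev : ∀ᶠ u' in 𝓝 u, ∀ J, u' ∈ D J → u ∈ D J := by
    refine eventually_all.2 fun J => ?_
    by_cases h : u ∈ D J
    · exact Eventually.of_forall fun _ _ => h
    · filter_upwards [(hD J).isOpen_compl.mem_nhds h] with u' hu' hmem using absurd hmem hu'
  filter_upwards [hev] with u' hu' x hx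
  rw [mem_normalCone_iff_of_convex hconv] at hx ⊢
  refine ⟨hx.1, hu' _ (fun x' _ hx' c hc => ?_) x hx.1 rfl⟩
  exact forall_inner_sub_le_zero_of_active_subset hx.1
    (fun i hi => (Set.ext_iff.1 hx' i).2 hi) hx.2 hc

/-- A linear form that is maximal over a convex set at a relative interior point is constant on
this set. -/
theorem inner_eq_zero_of_forall_inner_sub_nonneg {C : Set H} {q w : H}
    (hq : ∀ d ∈ vectorSpan ℝ C, ∃ t > (0 : ℝ), q + t • d ∈ C)
    (hw : ∀ c ∈ C, 0 ≤ inner ℝ w (q - c)) {d : H} (hd : d ∈ vectorSpan ℝ C) : inner ℝ w d = 0 := by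
  have key : ∀ d ∈ vectorSpan ℝ C, inner ℝ w d ≤ 0 := fun d hd => by
    obtain ⟨t, ht, hmem⟩ := hq d hd
    have := hw _ hmem
    rw [sub_add_cancel_left, inner_neg_right, inner_smul_right] at this
    exact nonpos_of_mul_nonpos_right (neg_nonneg.1 this) ht
  have := key (-d) (Submodule.neg_mem _ hd)
  rw [inner_neg_right] at this
  linarith [key d hd]

end PolyhedralSets

/-! ### Approximation by relative interior points -/

section RelativeInterior

variable {H : Type*} [NormedAddCommGroup H] [InnerProductSpace ℝ H] [FiniteDimensional ℝ H]

/-- Points of a convex set are limits of relative interior points. -/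
theorem exists_tendsto_relInterior {C : Set H} (hC : Convex ℝ C) {p : H} (hp : p ∈ C) :
    ∃ ps : ℕ → H, Tendsto ps atTop (𝓝 p) ∧ ∀ ν, ps ν ∈ C ∧
      ∀ᶠ q in 𝓝 (ps ν), q ∈ C → ∀ d ∈ vectorSpan ℝ C, ∃ t > (0 : ℝ), q + t • d ∈ C := by
  obtain ⟨p0, hp0⟩ := Set.Nonempty.intrinsicInterior hC ⟨p, hp⟩
  have hp0C := intrinsicInterior_subset hp0
  obtain ⟨z, hz, rfl⟩ := mem_intrinsicInterior.1 hp0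
  obtain ⟨δ, hδ, hball⟩ := Metric.mem_nhds_iff.1 (mem_interior_iff_mem_nhds.1 hz)
  have hint : ∀ q ∈ affineSpan ℝ C, dist q z < δ → q ∈ C := fun q hq hd =>
    hball (show (⟨q, hq⟩ : affineSpan ℝ C) ∈ Metric.ball z δ from hd)
  have hpos : ∀ ν : ℕ, (0 : ℝ) < 1 / ((ν : ℝ) + 1) := fun ν => by positivity
  have hmem : ∀ ν : ℕ, p + (1 / ((ν : ℝ) + 1)) • ((z : H) - p) ∈ C := fun ν => by
    refine hC.add_smul_sub_mem hp hp0C ⟨(hpos ν).le, ?_⟩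
    rw [div_le_one (by positivity)]
    simp
  refine ⟨fun ν => p + (1 / ((ν : ℝ) + 1)) • ((z : H) - p), ?_, fun ν => ⟨hmem ν, ?_⟩⟩
  · have := (tendsto_one_div_add_atTop_nhds_zero_nat (𝕜 := ℝ)).smul_const ((z : H) - p)
    simpa using this.const_add p
  set ε := 1 / ((ν : ℝ) + 1)
  have hε : 0 < ε := hpos ν
  have hε1 : ε ≤ 1 := by
    rw [div_le_one (by positivity)]
    simp
  -- The homothety with center `p` and ratio `ε` maps the relative `δ`-ball around `z` into `C`.
  have hcl : ∀ q ∈ affineSpan ℝ C, dist q (p + ε • ((z : H) - p)) < ε * δ → q ∈ C := by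
    intro q hq hd
    have hx : p + ε⁻¹ • (q - p) ∈ C := by
      refine hint _ ?_ ?_
      · have := AffineMap.lineMap_mem ε⁻¹ (mem_affineSpan ℝ hp) hq
        rwa [AffineMap.lineMap_apply, vsub_eq_sub, vadd_eq_add, add_comm] at this
      · have h1 : p + ε⁻¹ • (q - p) - z = ε⁻¹ • (q - (p + ε • ((z : H) - p))) := by
          rw [sub_add_eq_sub_sub, smul_sub ε⁻¹ (q - p), inv_smul_smul₀ hε.ne']
          abel
        rw [dist_eq_norm, h1, norm_smul, Real.norm_of_nonneg (inv_nonneg.2 hε.le), ← dist_eq_norm,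
          inv_mul_lt_iff₀ hε]
        exact hd
    have := hC.add_smul_sub_mem hp hx ⟨hε.le, hε1⟩
    rwa [add_sub_cancel_left, smul_inv_smul₀ hε.ne', add_sub_cancel] at this
  filter_upwards [Metric.ball_mem_nhds _ (mul_pos hε hδ)] with q hq hqC d hd
  have hcont : ContinuousAt (fun t : ℝ => q + t • d) 0 := by fun_prop
  have hev : ∀ᶠ t in 𝓝[>] (0 : ℝ), q + t • d ∈ Metric.ball (p + ε • ((z : H) - p)) (ε * δ) := by
    refine nhdsWithin_le_nhds (hcont.eventually (Metric.isOpen_ball.mem_nhds ?_))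
    change q + (0 : ℝ) • d ∈ _
    rwa [zero_smul, add_zero]
  obtain ⟨t, ht, ht0⟩ := (hev.and self_mem_nhdsWithin).exists
  refine ⟨t, ht0, hcl _ ?_ ht⟩
  rw [add_comm, ← vadd_eq_add]
  refine AffineSubspace.vadd_mem_of_mem_direction ?_ (mem_affineSpan ℝ hqC)
  rw [direction_affineSpan]
  exact Submodule.smul_mem _ _ hd

end RelativeInterior

/-! ### Normals to the graph of a polyhedral subdifferential -/

section SubgradientGraph

variable {E : Type*} [NormedAddCommGroup E] [InnerProductSpace ℝ E] {f : E → EReal}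

theorem inner_sub_sub_nonneg_of_mem_subdiff (hf : Convex ℝ (epi f)) {z z' p p' : E}
    (hp : p ∈ subdiff f z) (hp' : p' ∈ subdiff f z') : 0 ≤ inner ℝ (z - z') (p - p') := by
  rw [mem_subdiff_iff hf] at hp hp'
  obtain ⟨r, hr, h⟩ := hp
  obtain ⟨r', hr', h'⟩ := hp'
  have h1 := h z' r' hr'.le
  have h2 := h' z r hr.le
  rw [inner_sub_right]
  rw [← neg_sub, inner_neg_left] at h1
  linarith

theorem convex_subdiff (hf : Convex ℝ (epi f)) (x : E) : Convex ℝ (subdiff f x) := by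
  intro u hu v hv a b ha hb hab
  rw [mem_subdiff_iff hf] at *
  obtain ⟨r, hr, h⟩ := hu
  obtain ⟨r', hr', h'⟩ := hv
  obtain rfl : r = r' := by rwa [hr, EReal.coe_eq_coe_iff] at hr'
  refine ⟨r, hr, fun z t hz => ?_⟩
  rw [inner_add_right, inner_smul_right, inner_smul_right]
  have h1 := mul_le_mul_of_nonneg_left (h z t hz) ha
  have h2 := mul_le_mul_of_nonneg_left (h' z t hz) hb
  calc _ ≤ a * (t - r) + b * (t - r) := add_le_add h1 h2
    _ = t - r := by rw [← add_mul, hab, one_mul]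

theorem setOf_mem_subdiff_eq [CompleteSpace E] (hf : Proper f) (hp : EpiPolyhedral f) (p : E) :
    {z | p ∈ subdiff f z} = subdiff (conjugate f) p :=
  Set.ext fun _ => ⟨mem_subdiff_conjugate_of_mem_subdiff hp.convex,
    mem_subdiff_of_mem_subdiff_conjugate hf hp.convex hp.isClosed⟩

theorem EpiPolyhedral.eventually_mem_subdiff_of_nhds (hp : EpiPolyhedral f) (p : E) :
    ∀ᶠ p' in 𝓝 p, ∀ z, p' ∈ subdiff f z → p ∈ subdiff f z := by
  have hcont : Continuous fun p' : E => WithLp.toLp 2 (p', (-1 : ℝ)) := by fun_prop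
  filter_upwards [hcont.continuousAt.eventually
    (hp.eventually_mem_normalCone (WithLp.toLp 2 (p, (-1 : ℝ))))] with p' hp' z
  rintro ⟨r, hr, h⟩
  exact ⟨r, hr, hp' _ h⟩

/-- The subgradient inequalities at `z` and at `z' = q.1` squeeze `f z' - f z` between `⟨z' - z, p⟩`
and `⟨z' - z, q.2⟩`. So the epigraph point over `z'` is close to the one over `z`, where the normal
cone can only be larger. -/
theorem EpiPolyhedral.eventually_mem_subdiff_left (hf : EpiPolyhedral f) {z p : E}
    (hp : p ∈ subdiff f z) (p1 : E) :
    ∀ᶠ q : E × E in 𝓝 (z, p1), q.2 ∈ subdiff f q.1 → q.2 ∈ subdiff f z := by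
  have hp' := (mem_subdiff_iff hf.convex).1 hp
  obtain ⟨r, hr, h⟩ := hp'
  have hcont : Continuous fun q : E × ℝ => WithLp.toLp 2 q := by fun_prop
  have hev : ∀ᶠ q in 𝓝 (z, r), normalCone (epi f) (WithLp.toLp 2 q) ⊆
      normalCone (epi f) (WithLp.toLp 2 (z, r)) :=
    hcont.continuousAt.eventually (IsPolyhedral.eventually_normalCone_subset hf
      (x := WithLp.toLp 2 (z, r)) hr.le)
  obtain ⟨ε, hε, hball⟩ := Metric.eventually_nhds_iff.1 hev
  have h1 : ContinuousAt (fun q : E × E => inner ℝ (q.1 - z) p) (z, p1) := by fun_prop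
  have h2 : ContinuousAt (fun q : E × E => inner ℝ (q.1 - z) q.2) (z, p1) := by fun_prop
  have h3 : ContinuousAt (fun q : E × E => dist q.1 z) (z, p1) := by fun_prop
  filter_upwards [h1.eventually (Ioi_mem_nhds (show -ε < _ by simpa using hε)),
    h2.eventually (Iio_mem_nhds (show _ < ε by simpa using hε)),
    h3.eventually (Iio_mem_nhds (show _ < ε by simpa using hε))] with q hq1 hq2 hq3 hq
  have hq' := (mem_subdiff_iff hf.convex).1 hq
  obtain ⟨r', hr', h'⟩ := hq'
  obtain ⟨r'', hr'', hN⟩ := hq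
  obtain rfl : r' = r'' := by rwa [hr', EReal.coe_eq_coe_iff] at hr''
  have ha := h q.1 r' hr'.le
  have hb := h' z r hr.le
  rw [← neg_sub, inner_neg_left] at hb
  change -ε < inner ℝ (q.1 - z) p at hq1
  change inner ℝ (q.1 - z) q.2 < ε at hq2
  refine ⟨r, hr, hball (y := (q.1, r')) ?_ hN⟩
  rw [Prod.dist_eq, max_lt_iff, Real.dist_eq, abs_lt]
  exact ⟨hq3, by simp only; linarith, by simp only; linarith⟩

theorem tendsto_of_tendsto_difference_quotient {V : Type*} [NormedAddCommGroup V]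
    [NormedSpace ℝ V] {xs : ℕ → V} {τ : ℕ → ℝ} {x w : V} (hτ : ∀ ν, 0 < τ ν)
    (hτ0 : Tendsto τ atTop (𝓝 0)) (hw : Tendsto (fun ν => (τ ν)⁻¹ • (xs ν - x)) atTop (𝓝 w)) :
    Tendsto xs atTop (𝓝 x) := by
  have := (hτ0.smul hw).add_const x
  rw [zero_smul, zero_add] at this
  refine this.congr fun ν => ?_
  rw [smul_inv_smul₀ (hτ ν).ne', sub_add_cancel]

theorem mem_regularNormalCone_of_eventually_inner_eq_zero {V : Type*} [NormedAddCommGroup V]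
    [InnerProductSpace ℝ V] {C : Set V} {x u : V}
    (h : ∀ᶠ c in 𝓝 x, c ∈ C → inner ℝ (c - x) u = 0) : u ∈ regularNormalCone C x := by
  rintro w ⟨xs, τ, hxs, hτ, hτ0, hw⟩
  refine le_of_tendsto (hw.inner tendsto_const_nhds) ?_
  filter_upwards [(tendsto_of_tendsto_difference_quotient hτ hτ0 hw).eventually h] with ν hν
  rw [real_inner_smul_left, hν (hxs ν), mul_zero]

variable [FiniteDimensional ℝ E]

/-- Approach `p` by relative interior points of `∂f(z)`. Near these, a graph point `(z', p')` has
`p'` again relatively interior to `∂f(z)`, and monotonicity makes `z' - z` maximal there as a linear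
form on `∂f(z)`. Hence `z' - z` is orthogonal to `d`, and `(d, 0)` is a regular normal. -/
theorem EpiPolyhedral.toLp_zero_mem_normalCone_gph (hf : EpiPolyhedral f) {z p d : E}
    (hp : p ∈ subdiff f z) (hd : d ∈ vectorSpan ℝ (subdiff f z)) :
    WithLp.toLp 2 (d, (0 : E)) ∈ normalCone (gph (subdiff f)) (WithLp.toLp 2 (z, p)) := by
  obtain ⟨ps, hps, hri⟩ := exists_tendsto_relInterior (convex_subdiff hf.convex z) hp
  have hcont : Continuous fun q : E × E => WithLp.toLp 2 q := by fun_prop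
  refine ⟨hp, fun ν => WithLp.toLp 2 (z, ps ν), fun _ => WithLp.toLp 2 (d, 0), fun ν => (hri ν).1,
    fun ν => ?_, (hcont.tendsto _).comp (tendsto_const_nhds.prodMk_nhds hps), tendsto_const_nhds⟩
  refine mem_regularNormalCone_of_eventually_inner_eq_zero ?_
  have hcont' : Continuous fun q : WithLp 2 (E × E) => (q.fst, q.snd) := by fun_prop
  have hsnd : Continuous fun q : WithLp 2 (E × E) => q.snd := by fun_prop
  filter_upwards [hcont'.continuousAt.eventually (hf.eventually_mem_subdiff_left hp (ps ν)),
    hsnd.continuousAt.eventually (hri ν).2] with q hq1 hq2 hq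
  have hqz := hq1 hq
  have := inner_eq_zero_of_forall_inner_sub_nonneg (w := q.fst - z) (hq2 hqz)
    (fun c hc => inner_sub_sub_nonneg_of_mem_subdiff hf.convex hq hc) hd
  simpa [WithLp.prod_inner_apply, real_inner_comm] using this

/-- The dual argument: here `z` is approached within the relative interior of `∂f*(p)`. -/
theorem EpiPolyhedral.zero_toLp_mem_normalCone_gph (hf : EpiPolyhedral f) (hproper : Proper f)
    {z p d : E} (hp : p ∈ subdiff f z) (hd : d ∈ vectorSpan ℝ {z' | p ∈ subdiff f z'}) :
    WithLp.toLp 2 ((0 : E), d) ∈ normalCone (gph (subdiff f)) (WithLp.toLp 2 (z, p)) := by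
  have := FiniteDimensional.complete ℝ E
  have hconv : Convex ℝ {z' | p ∈ subdiff f z'} := by
    rw [setOf_mem_subdiff_eq hproper hf]
    exact convex_subdiff (convex_epi_conjugate f) p
  obtain ⟨zs, hzs, hri⟩ := exists_tendsto_relInterior hconv hp
  have hcont : Continuous fun q : E × E => WithLp.toLp 2 q := by fun_prop
  refine ⟨hp, fun ν => WithLp.toLp 2 (zs ν, p), fun _ => WithLp.toLp 2 (0, d), fun ν => (hri ν).1,
    fun ν => ?_, (hcont.tendsto _).comp (hzs.prodMk_nhds tendsto_const_nhds), tendsto_const_nhds⟩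
  refine mem_regularNormalCone_of_eventually_inner_eq_zero ?_
  have hfst : Continuous fun q : WithLp 2 (E × E) => q.fst := by fun_prop
  have hsnd : Continuous fun q : WithLp 2 (E × E) => q.snd := by fun_prop
  filter_upwards [hsnd.continuousAt.eventually (hf.eventually_mem_subdiff_of_nhds p),
    hfst.continuousAt.eventually (hri ν).2] with q hq1 hq2 hq
  have hqz := hq1 _ hq
  have := inner_eq_zero_of_forall_inner_sub_nonneg (w := q.snd - p) (hq2 hqz)
    (fun c hc => by
      rw [real_inner_comm]
      exact inner_sub_sub_nonneg_of_mem_subdiff hf.convex hq hc) hd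
  simpa [WithLp.prod_inner_apply, real_inner_comm] using this

end SubgradientGraph

/-! ### Strict differentiability and convex minimization -/

section Calculus

/-- A strictly differentiable map separates nearby points that differ by a vector of a
finite-dimensional space on which its derivative is injective. -/
theorem eventually_eq_zero_of_injective_comp {A B D : Type*}
    [NormedAddCommGroup A] [NormedSpace ℝ A] [NormedAddCommGroup B] [NormedSpace ℝ B]
    [NormedAddCommGroup D] [NormedSpace ℝ D] [FiniteDimensional ℝ D] {Θ : A → B} {Θ' : A →L[ℝ] B}
    {a : A} (hΘ : HasStrictFDerivAt Θ Θ' a) (ι : D →L[ℝ] A)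
    (hinj : Function.Injective (Θ'.comp ι)) :
    ∀ᶠ q : A × A in 𝓝 (a, a), ∀ d, q.1 - q.2 = ι d → Θ q.1 = Θ q.2 → d = 0 := by
  obtain ⟨κ, hκ, hanti⟩ := (Θ'.comp ι).toLinearMap.exists_antilipschitzWith
    (LinearMap.ker_eq_bot.2 hinj)
  have hbound : ∀ d, ‖d‖ ≤ κ * ‖Θ' (ι d)‖ := fun d =>
    ZeroHomClass.bound_of_antilipschitz (Θ'.comp ι) hanti d
  -- This error bound yields `‖d‖ ≤ ‖d‖ / 2`; the `+ 1` covers `ι = 0`.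
  have hε : (0 : ℝ) < (2 * κ * (‖ι‖ + 1))⁻¹ := by positivity
  filter_upwards [hΘ.isLittleO.def hε] with q hq d hd heq
  rw [heq, sub_self, zero_sub, norm_neg, hd] at hq
  have h1 := hbound d
  have h2 := ι.le_opNorm d
  have h3 : ‖d‖ ≤ κ * ((2 * κ * (‖ι‖ + 1))⁻¹ * ((‖ι‖ + 1) * ‖d‖)) := by
    refine h1.trans (mul_le_mul_of_nonneg_left (hq.trans ?_) κ.2)
    gcongr
    nlinarith [norm_nonneg d]
  have h4 : (κ : ℝ) * ((2 * κ * (‖ι‖ + 1))⁻¹ * ((‖ι‖ + 1) * ‖d‖)) = ‖d‖ / 2 := by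
    have : (κ : ℝ) ≠ 0 := by positivity
    have : ‖ι‖ + 1 ≠ 0 := by positivity
    field_simp
  rw [h4] at h3
  exact norm_le_zero_iff.1 (by linarith)

/-- A differentiable convex function is minimal where its gradient vanishes. -/
theorem le_of_convexOn_of_gradient_eq_zero {E : Type*} [NormedAddCommGroup E]
    [InnerProductSpace ℝ E] [CompleteSpace E] {f : E → ℝ} (hf : ConvexOn ℝ univ f) {x : E}
    (hd : DifferentiableAt ℝ f x) (h0 : gradient f x = 0) (u : E) : f x ≤ f u := by
  have hf0 : fderiv ℝ f x = 0 := by rw [← toDual_gradient, h0, map_zero]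
  have hline : HasDerivAt (fun t : ℝ => f (AffineMap.lineMap x u t)) 0 0 := by
    have h1 : HasFDerivAt f (fderiv ℝ f x) (AffineMap.lineMap x u (0 : ℝ)) := by
      rw [AffineMap.lineMap_apply_zero]
      exact hd.hasFDerivAt
    have := h1.comp_hasDerivAt (0 : ℝ) (AffineMap.hasDerivAt_lineMap (a := x) (b := u))
    simp only [hf0, zero_apply] at this
    exact this
  have hconv : ConvexOn ℝ univ (fun t : ℝ => f (AffineMap.lineMap x u t)) :=
    hf.comp_affineMap (AffineMap.lineMap x u)
  have := hconv.le_slope_of_hasDerivAt (mem_univ _) (mem_univ _) zero_lt_one hline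
  simpa [slope_def_field] using this

/-- The Riesz isomorphism from the dual as a real-linear map. -/
def rieszSymm (E : Type*) [NormedAddCommGroup E] [InnerProductSpace ℝ E] [CompleteSpace E] :
    StrongDual ℝ E →L[ℝ] E where
  toFun ℓ := (InnerProductSpace.toDual ℝ E).symm ℓ
  map_add' := map_add _
  map_smul' c ℓ := by simp
  cont := (InnerProductSpace.toDual ℝ E).symm.continuous

end Calculus

/-! ### Derivatives of the Lagrangian -/

section LagrangianCalculus

variable {n m s : ℕ}
  {g : EuclideanSpace ℝ (Fin n) → EuclideanSpace ℝ (Fin m) → ℝ}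
  {h : EuclideanSpace ℝ (Fin s) → EReal}
  {G : EuclideanSpace ℝ (Fin n) → EuclideanSpace ℝ (Fin m) → EuclideanSpace ℝ (Fin s)}

theorem gradient_add_jacYT (x : EuclideanSpace ℝ (Fin n)) {y : EuclideanSpace ℝ (Fin m)}
    (p : EuclideanSpace ℝ (Fin s)) (hg : DifferentiableAt ℝ (g x) y)
    (hG : DifferentiableAt ℝ (G x) y) :
    gradient (fun y' => g x y' + inner ℝ (G x y') p) y = gradient (g x) y + jacYT G x y p := by
  refine HasGradientAt.gradient ?_
  rw [hasGradientAt_iff_hasFDerivAt]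
  have h1 := hg.hasFDerivAt.add (hG.hasFDerivAt.inner ℝ (hasFDerivAt_const p y))
  refine h1.congr_fderiv ?_
  ext v
  simp [jacYT, jacY, ContinuousLinearMap.adjoint_inner_left, real_inner_comm]

theorem hessLagrangian_eq {x : EuclideanSpace ℝ (Fin n)} {y : EuclideanSpace ℝ (Fin m)}
    {p : EuclideanSpace ℝ (Fin s)} {k : ℝ} (hk : conjugate h p = k) :
    hessLagrangian g h G x y p =
      fderiv ℝ (gradient fun y' => g x y' + inner ℝ (G x y') p) y := by
  have h1 : (fun y' => (lagrangian g h G x y' p).toReal) =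
      fun y' => g x y' + inner ℝ (G x y') p - k := by
    funext y'
    rw [lagrangian, hk, ← EReal.coe_sub, EReal.toReal_coe]
  have h2 : (gradient fun y' => g x y' + inner ℝ (G x y') p - k) =
      gradient fun y' => g x y' + inner ℝ (G x y') p := by
    funext y'
    rw [gradient, gradient, fderiv_sub_const]
  rw [hessLagrangian, h1, h2]

theorem contDiff_gradient_lagrangian
    (hg : ContDiff ℝ 2 fun q : EuclideanSpace ℝ (Fin n) × EuclideanSpace ℝ (Fin m) => g q.1 q.2)
    (hG : ContDiff ℝ 2 fun q : EuclideanSpace ℝ (Fin n) × EuclideanSpace ℝ (Fin m) => G q.1 q.2) :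
    ContDiff ℝ 1 fun q : EuclideanSpace ℝ (Fin n) × EuclideanSpace ℝ (Fin m) ×
      EuclideanSpace ℝ (Fin s) =>
        gradient (fun y' => g q.1 y' + inner ℝ (G q.1 y') q.2.2) q.2.1 := by
  refine (rieszSymm (EuclideanSpace ℝ (Fin m))).contDiff.comp (ContDiff.fderiv (m := 2)
    (f := fun (q : EuclideanSpace ℝ (Fin n) × EuclideanSpace ℝ (Fin m) ×
      EuclideanSpace ℝ (Fin s)) y' => g q.1 y' + inner ℝ (G q.1 y') q.2.2)
    (g := fun q => q.2.1) ?_ (by fun_prop) (by norm_num))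
  have h1 : ContDiff ℝ 2 fun q : (EuclideanSpace ℝ (Fin n) × EuclideanSpace ℝ (Fin m) ×
      EuclideanSpace ℝ (Fin s)) × EuclideanSpace ℝ (Fin m) => (q.1.1, q.2) := by fun_prop
  exact (hg.comp h1).add ((hG.comp h1).inner ℝ (by fun_prop))

end LagrangianCalculus

/-! ### Solutions of the lower-level problem as saddle points -/

section LowerLevelSaddle

variable {n m s : ℕ}
  {g : EuclideanSpace ℝ (Fin n) → EuclideanSpace ℝ (Fin m) → ℝ}
  {h : EuclideanSpace ℝ (Fin s) → EReal}
  {G : EuclideanSpace ℝ (Fin n) → EuclideanSpace ℝ (Fin m) → EuclideanSpace ℝ (Fin s)}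

section Saddle

/-- The epigraph of the conjugate as a subset of the plain product. -/
def conjEpi (h : EuclideanSpace ℝ (Fin s) → EReal) : Set (EuclideanSpace ℝ (Fin s) × ℝ) :=
  {P | conjugate h P.1 ≤ (P.2 : EReal)}

/-- The Lagrangian with `h*(p)` replaced by an epigraphical variable. -/
def epiLagrangian (g : EuclideanSpace ℝ (Fin n) → EuclideanSpace ℝ (Fin m) → ℝ)
    (G : EuclideanSpace ℝ (Fin n) → EuclideanSpace ℝ (Fin m) → EuclideanSpace ℝ (Fin s))
    (x : EuclideanSpace ℝ (Fin n)) (y : EuclideanSpace ℝ (Fin m))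
    (P : EuclideanSpace ℝ (Fin s) × ℝ) : ℝ :=
  g x y + inner ℝ (G x y) P.1 - P.2

theorem isClosed_conjEpi : IsClosed (conjEpi h) := by
  simp only [conjEpi, conjugate_le_iff, Set.ofPred_forall]
  exact isClosed_iInter fun z => isClosed_iInter fun ρ => isClosed_iInter fun _ =>
    isClosed_le (by fun_prop) (by fun_prop)

theorem convex_conjEpi : Convex ℝ (conjEpi h) := fun P hP Q hQ _ _ ha hb hab =>
  convex_epi_conjugate h (x := WithLp.toLp 2 P) hP (y := WithLp.toLp 2 Q) hQ ha hb hab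

/-- Lowering coordinate `i` does not increase `h`, so `p i < 0` would make the supremum defining
`h*(p)` infinite. -/
theorem Nondecreasing.nonneg_of_conjugate_le (hmono : Nondecreasing h) (hproper : Proper h)
    {p : EuclideanSpace ℝ (Fin s)} {r : ℝ} (hp : conjugate h p ≤ r) (i : Fin s) : 0 ≤ p i := by
  obtain ⟨z, ρ, hz⟩ := hproper.exists_le_coe
  rw [conjugate_le_iff] at hp
  by_contra! hneg
  set t := (|r + ρ - inner ℝ z p| + 1) / (-p i) with ht
  have ht0 : 0 < t := div_pos (by positivity) (neg_pos.2 hneg)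
  have h1 := hp (z - t • EuclideanSpace.single i (1 : ℝ)) ρ ((hmono _ _ fun j => by
    by_cases hj : j = i
    · simp [hj, ht0.le]
    · simp [hj]).trans hz)
  rw [inner_sub_left, real_inner_smul_left, EuclideanSpace.inner_single_left] at h1
  have h2 : t * -p i = |r + ρ - inner ℝ z p| + 1 := div_mul_cancel₀ _ (neg_pos.2 hneg).ne'
  simp only [map_one, one_mul] at h1
  have := le_abs_self (r + ρ - inner ℝ z p)
  linarith

theorem convexOn_lagrangian {x : EuclideanSpace ℝ (Fin n)} (hg : ConvexOn ℝ univ (g x))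
    (hG : ∀ i, ConvexOn ℝ univ fun y => G x y i) {p : EuclideanSpace ℝ (Fin s)}
    (hp : ∀ i, 0 ≤ p i) : ConvexOn ℝ univ fun y => g x y + inner ℝ (G x y) p := by
  refine hg.add ⟨convex_univ, fun a _ b _ α β hα hβ hαβ => ?_⟩
  simp only [PiLp.inner_apply, smul_eq_mul, Finset.mul_sum, ← Finset.sum_add_distrib]
  refine Finset.sum_le_sum fun i _ => ?_
  have := mul_le_mul_of_nonneg_left ((hG i).2 (mem_univ a) (mem_univ b) hα hβ hαβ) (hp i)
  simp only [smul_eq_mul] at this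
  simp only [RCLike.inner_apply, conj_trivial]
  linarith

theorem convexOn_epiLagrangian (hmono : Nondecreasing h) (hproper : Proper h)
    {x : EuclideanSpace ℝ (Fin n)} (hg : ConvexOn ℝ univ (g x))
    (hG : ∀ i, ConvexOn ℝ univ fun y => G x y i) {P : EuclideanSpace ℝ (Fin s) × ℝ}
    (hP : P ∈ conjEpi h) : ConvexOn ℝ univ fun y => epiLagrangian g G x y P := by
  have := (convexOn_lagrangian hg hG (hmono.nonneg_of_conjugate_le hproper hP)).add_const (-P.2)
  simp only [epiLagrangian, sub_eq_add_neg]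
  exact this

theorem concaveOn_epiLagrangian (x : EuclideanSpace ℝ (Fin n)) (y : EuclideanSpace ℝ (Fin m)) :
    ConcaveOn ℝ (conjEpi h) (epiLagrangian g G x y) := by
  refine ⟨convex_conjEpi, fun P _ Q _ α β _ _ hαβ => le_of_eq ?_⟩
  simp only [epiLagrangian, Prod.fst_add, Prod.smul_fst, Prod.snd_add, Prod.smul_snd,
    inner_add_right, inner_smul_right, smul_eq_mul]
  linear_combination g x y * hαβ

theorem mem_S_iff {x : EuclideanSpace ℝ (Fin n)} {y : EuclideanSpace ℝ (Fin m)}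
    {p : EuclideanSpace ℝ (Fin s)} (hg : Differentiable ℝ (g x)) (hG : Differentiable ℝ (G x)) :
    (y, p) ∈ S g h G x ↔
      gradient (fun y' => g x y' + inner ℝ (G x y') p) y = 0 ∧
        G x y ∈ subdiff (conjugate h) p := by
  rw [gradient_add_jacYT x p (hg y) (hG y)]
  refine and_congr_left fun _ => ?_
  dsimp only
  rw [eq_comm, ← neg_add', neg_eq_zero]

/-- The solution mapping consists of the saddle points of the Lagrangian. -/
theorem mem_S_iff_exists_mem_saddleSet (hmono : Nondecreasing h) (hproper : Proper h)
    {x : EuclideanSpace ℝ (Fin n)} (hg : ConvexOn ℝ univ (g x))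
    (hG : ∀ i, ConvexOn ℝ univ fun y => G x y i) (hgd : Differentiable ℝ (g x))
    (hGd : Differentiable ℝ (G x)) {y : EuclideanSpace ℝ (Fin m)}
    {p : EuclideanSpace ℝ (Fin s)} {r : ℝ} :
    (y, p) ∈ S g h G x ∧ conjugate h p = r ↔
      (y, (p, r)) ∈ saddleSet univ (conjEpi h) (epiLagrangian g G x) := by
  have hdiff : Differentiable ℝ fun y' => g x y' + inner ℝ (G x y') p :=
    hgd.add (hGd.inner ℝ (differentiable_const p))
  rw [mem_S_iff hgd hGd, mem_subdiff_iff (convex_epi_conjugate h)]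
  constructor
  · rintro ⟨⟨h0, k, hk, hsub⟩, hr⟩
    obtain rfl : k = r := by rwa [hk, EReal.coe_eq_coe_iff] at hr
    refine ⟨mem_univ _, hr.le, fun u _ Q hQ => ?_⟩
    have h1 := le_of_convexOn_of_gradient_eq_zero
      (convexOn_lagrangian hg hG (hmono.nonneg_of_conjugate_le hproper hr.le)) (hdiff y) h0 u
    have h2 := hsub Q.1 Q.2 hQ
    rw [inner_sub_left, real_inner_comm, real_inner_comm _ p] at h2
    simp only [epiLagrangian] at h1 ⊢
    linarith
  · rintro ⟨-, hp, hs⟩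
    obtain ⟨k, hk, hkr⟩ := eq_coe_of_le_coe hproper.conjugate_ne_bot hp
    dsimp only at hp hs hk hkr
    -- Maximality against `(p, h*(p))` forces `r = h*(p)`.
    have hrk := hs y (mem_univ y) (p, k) hk.le
    simp only [epiLagrangian] at hrk
    obtain rfl : k = r := by linarith
    refine ⟨⟨?_, k, hk, fun q t hq => ?_⟩, hk⟩
    · rw [gradient, IsLocalMin.fderiv_eq_zero, map_zero]
      refine Eventually.of_forall fun u => ?_
      have := hs u (mem_univ u) (p, k) hk.le
      simp only [epiLagrangian] at this ⊢
      linarith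
    · have := hs y (mem_univ y) (q, t) hq
      simp only [epiLagrangian] at this
      rw [inner_sub_left, real_inner_comm, real_inner_comm _ p]
      linarith

end Saddle

/-! ### Local uniqueness from the second-order condition -/

section SecondOrder

variable {x : EuclideanSpace ℝ (Fin n)} {y : EuclideanSpace ℝ (Fin m)}
  {p : EuclideanSpace ℝ (Fin s)}

theorem SOSC.eq_zero_of_hessLagrangian_eq_zero (hproper : Proper h) (hpoly : EpiPolyhedral h)
    (hSOSC : SOSC g h G x y p) (hp : p ∈ subdiff h (G x y)) {w : EuclideanSpace ℝ (Fin m)}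
    (hw : hessLagrangian g h G x y p w = 0)
    (hJ : jacY G x y w ∈ vectorSpan ℝ {z | p ∈ subdiff h z}) : w = 0 := by
  refine (hSOSC w 0 ?_ ?_).1
  · rw [hw, map_zero, neg_zero]
  · exact hpoly.zero_toLp_mem_normalCone_gph hproper hp (Submodule.neg_mem _ hJ)

theorem SOSC.eq_zero_of_jacYT_eq_zero (hpoly : EpiPolyhedral h)
    (hSOSC : SOSC g h G x y p) (hp : p ∈ subdiff h (G x y)) {d : EuclideanSpace ℝ (Fin s)}
    (hd : d ∈ vectorSpan ℝ (subdiff h (G x y))) (hJ : jacYT G x y d = 0) : d = 0 := by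
  refine (hSOSC 0 d ?_ ?_).2
  · rw [hJ, map_zero, neg_zero]
  · rw [coderiv, mem_ofPred_eq, map_zero, neg_zero]
    exact hpoly.toLp_zero_mem_normalCone_gph hp hd

/-- Local uniqueness of the primal solution for a fixed multiplier. -/
theorem SOSC.eventually_primal_eq (hproper : Proper h) (hpoly : EpiPolyhedral h)
    (hg : ContDiff ℝ 2 fun q : EuclideanSpace ℝ (Fin n) × EuclideanSpace ℝ (Fin m) => g q.1 q.2)
    (hG : ContDiff ℝ 2 fun q : EuclideanSpace ℝ (Fin n) × EuclideanSpace ℝ (Fin m) => G q.1 q.2)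
    (hSOSC : SOSC g h G x y p) (hp : p ∈ subdiff h (G x y)) {k : ℝ} (hk : conjugate h p = k) :
    ∀ᶠ q : (EuclideanSpace ℝ (Fin n) × EuclideanSpace ℝ (Fin m) × EuclideanSpace ℝ (Fin s)) ×
        (EuclideanSpace ℝ (Fin n) × EuclideanSpace ℝ (Fin m) × EuclideanSpace ℝ (Fin s)) in
      𝓝 ((x, y, p), (x, y, p)), ∀ x' y₁ y₂ p', q = ((x', y₁, p'), (x', y₂, p')) →
        gradient (fun y' => g x' y' + inner ℝ (G x' y') p') y₁ =
          gradient (fun y' => g x' y' + inner ℝ (G x' y') p') y₂ →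
        G x' y₁ - G x' y₂ ∈ vectorSpan ℝ {z | p ∈ subdiff h z} → y₁ = y₂ := by
  set V := vectorSpan ℝ {z | p ∈ subdiff h z}
  let Ψ := fun q : EuclideanSpace ℝ (Fin n) × EuclideanSpace ℝ (Fin m) ×
    EuclideanSpace ℝ (Fin s) => gradient (fun y' => g q.1 y' + inner ℝ (G q.1 y') q.2.2) q.2.1
  have hΨ : ContDiff ℝ 1 Ψ := contDiff_gradient_lagrangian hg hG
  -- The second component encodes membership in `V` as an equation: `G`-values differing by an
  -- element of `V` have the same projection onto `Vᗮ`.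
  let Θ := fun q : EuclideanSpace ℝ (Fin n) × EuclideanSpace ℝ (Fin m) ×
    EuclideanSpace ℝ (Fin s) => (Ψ q, Vᗮ.starProjection (G q.1 q.2.1))
  have hΘ : ContDiff ℝ 1 Θ := hΨ.prodMk (Vᗮ.starProjection.contDiff.comp
    ((hG.of_le one_le_two).comp (by fun_prop : ContDiff ℝ 1 fun q : EuclideanSpace ℝ (Fin n) ×
      EuclideanSpace ℝ (Fin m) × EuclideanSpace ℝ (Fin s) => (q.1, q.2.1))))
  have hstrict := hΘ.hasStrictFDerivAt (x := (x, y, p)) one_ne_zero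
  let ι : EuclideanSpace ℝ (Fin m) →L[ℝ] EuclideanSpace ℝ (Fin n) × EuclideanSpace ℝ (Fin m) ×
    EuclideanSpace ℝ (Fin s) := ContinuousLinearMap.prod 0 (ContinuousLinearMap.prod (.id ℝ _) 0)
  have hcurve : HasFDerivAt (fun y' : EuclideanSpace ℝ (Fin m) => (x, y', p)) ι y :=
    (hasFDerivAt_const x y).prodMk ((hasFDerivAt_id y).prodMk (hasFDerivAt_const p y))
  have h1 : HasFDerivAt (fun y' => Ψ (x, y', p)) (hessLagrangian g h G x y p) y := by
    rw [hessLagrangian_eq hk]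
    exact ((hΨ.differentiable one_ne_zero).differentiableAt.comp y
      hcurve.differentiableAt).hasFDerivAt
  have hGx : DifferentiableAt ℝ (G x) y := by
    have : ContDiff ℝ 2 (G x) := hG.comp (contDiff_prodMk_right x)
    exact (this.differentiable two_ne_zero) y
  have h2 := h1.prodMk (Vᗮ.starProjection.hasFDerivAt.comp y hGx.hasFDerivAt)
  have hder := (hstrict.hasFDerivAt.comp y hcurve).unique h2
  have hinj : Function.Injective ((fderiv ℝ Θ (x, y, p)).comp ι) := by
    rw [hder]
    refine (injective_iff_map_eq_zero _).2 fun w hw => ?_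
    rw [ContinuousLinearMap.prod_apply, Prod.mk_eq_zero] at hw
    refine hSOSC.eq_zero_of_hessLagrangian_eq_zero hproper hpoly hp hw.1 ?_
    have := (Submodule.starProjection_apply_eq_zero_iff _).1 hw.2
    rwa [Submodule.orthogonal_orthogonal] at this
  filter_upwards [eventually_eq_zero_of_injective_comp hstrict ι hinj] with q hq
  rintro x' y₁ y₂ p' rfl hgrad hV
  refine sub_eq_zero.1 (hq (y₁ - y₂) ?_ ?_)
  · simp [ι]
  · refine Prod.ext hgrad (sub_eq_zero.1 ?_)
    rw [← map_sub, Submodule.starProjection_apply_eq_zero_iff, Submodule.orthogonal_orthogonal]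
    exact hV

/-- Local uniqueness of the multiplier for a fixed primal solution. -/
theorem SOSC.eventually_dual_eq (hpoly : EpiPolyhedral h)
    (hg : ContDiff ℝ 2 fun q : EuclideanSpace ℝ (Fin n) × EuclideanSpace ℝ (Fin m) => g q.1 q.2)
    (hG : ContDiff ℝ 2 fun q : EuclideanSpace ℝ (Fin n) × EuclideanSpace ℝ (Fin m) => G q.1 q.2)
    (hSOSC : SOSC g h G x y p) (hp : p ∈ subdiff h (G x y)) :
    ∀ᶠ q : (EuclideanSpace ℝ (Fin n) × EuclideanSpace ℝ (Fin m) × EuclideanSpace ℝ (Fin s)) ×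
        (EuclideanSpace ℝ (Fin n) × EuclideanSpace ℝ (Fin m) × EuclideanSpace ℝ (Fin s)) in
      𝓝 ((x, y, p), (x, y, p)), ∀ x' y' p₁ p₂, q = ((x', y', p₁), (x', y', p₂)) →
        gradient (fun y' => g x' y' + inner ℝ (G x' y') p₁) y' =
          gradient (fun y' => g x' y' + inner ℝ (G x' y') p₂) y' →
        p₁ - p₂ ∈ vectorSpan ℝ (subdiff h (G x y)) → p₁ = p₂ := by
  set W := vectorSpan ℝ (subdiff h (G x y))
  let Ψ := fun q : EuclideanSpace ℝ (Fin n) × EuclideanSpace ℝ (Fin m) ×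
    EuclideanSpace ℝ (Fin s) => gradient (fun y' => g q.1 y' + inner ℝ (G q.1 y') q.2.2) q.2.1
  have hΨ : ContDiff ℝ 1 Ψ := contDiff_gradient_lagrangian hg hG
  have hstrict := hΨ.hasStrictFDerivAt (x := (x, y, p)) one_ne_zero
  let κ : EuclideanSpace ℝ (Fin s) →L[ℝ] EuclideanSpace ℝ (Fin n) × EuclideanSpace ℝ (Fin m) ×
    EuclideanSpace ℝ (Fin s) := ContinuousLinearMap.prod 0 (ContinuousLinearMap.prod 0 (.id ℝ _))
  have hcurve : HasFDerivAt (fun p' : EuclideanSpace ℝ (Fin s) => (x, y, p')) κ p :=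
    (hasFDerivAt_const x p).prodMk ((hasFDerivAt_const y p).prodMk (hasFDerivAt_id p))
  have hgx : DifferentiableAt ℝ (g x) y := by
    have : ContDiff ℝ 2 (g x) := hg.comp (contDiff_prodMk_right x)
    exact (this.differentiable two_ne_zero) y
  have hGx : DifferentiableAt ℝ (G x) y := by
    have : ContDiff ℝ 2 (G x) := hG.comp (contDiff_prodMk_right x)
    exact (this.differentiable two_ne_zero) y
  have h1 : HasFDerivAt (fun p' => Ψ (x, y, p')) (jacYT G x y) p := by
    have : (fun p' => Ψ (x, y, p')) = fun p' => gradient (g x) y + jacYT G x y p' :=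
      funext fun p' => gradient_add_jacYT x p' hgx hGx
    rw [this]
    exact (jacYT G x y).hasFDerivAt.const_add _
  have h2 : HasFDerivAt (fun p' => Ψ (x, y, p')) ((fderiv ℝ Ψ (x, y, p)).comp κ) p :=
    HasFDerivAt.comp (g := Ψ) (f := fun p' => (x, y, p')) p hstrict.hasFDerivAt hcurve
  have hder := h2.unique h1
  -- Only multiplier differences in `W` matter, so `∇_y Gᵀ` need only be injective there.
  have hinj : Function.Injective ((fderiv ℝ Ψ (x, y, p)).comp (κ.comp W.subtypeL)) := by
    rw [← ContinuousLinearMap.comp_assoc, hder]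
    refine (injective_iff_map_eq_zero _).2 fun d hd => ?_
    exact Subtype.ext (hSOSC.eq_zero_of_jacYT_eq_zero hpoly hp d.2 hd)
  filter_upwards [eventually_eq_zero_of_injective_comp hstrict _ hinj] with q hq
  rintro x' y' p₁ p₂ rfl hgrad hW
  have := hq ⟨p₁ - p₂, hW⟩ (by simp [κ]) hgrad
  exact sub_eq_zero.1 (congrArg Subtype.val this)

end SecondOrder

end LowerLevelSaddle

/-- Under the second-order condition, saddle points close to the given one are unique for all
nearby parameters. -/
theorem SOSC.eventually_saddleSet_subsingleton {n m s : ℕ}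
    {g : EuclideanSpace ℝ (Fin n) → EuclideanSpace ℝ (Fin m) → ℝ}
    {h : EuclideanSpace ℝ (Fin s) → EReal}
    {G : EuclideanSpace ℝ (Fin n) → EuclideanSpace ℝ (Fin m) → EuclideanSpace ℝ (Fin s)}
    (hg : ContDiff ℝ 2 fun q : EuclideanSpace ℝ (Fin n) × EuclideanSpace ℝ (Fin m) => g q.1 q.2)
    (hG : ContDiff ℝ 2 fun q : EuclideanSpace ℝ (Fin n) × EuclideanSpace ℝ (Fin m) => G q.1 q.2)
    (hg_conv : ∀ x, ConvexOn ℝ univ (g x)) (hG_conv : ∀ x i, ConvexOn ℝ univ fun y => G x y i)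
    (hproper : Proper h) (hpoly : EpiPolyhedral h) (hmono : Nondecreasing h)
    {x : EuclideanSpace ℝ (Fin n)} {y : EuclideanSpace ℝ (Fin m)}
    {p : EuclideanSpace ℝ (Fin s)} {k : ℝ} (hp : p ∈ subdiff h (G x y))
    (hk : conjugate h p = k) (hSOSC : SOSC g h G x y p) :
    ∃ ε > 0, ∀ᶠ x' in 𝓝 x,
      ∀ q ∈ saddleSet univ (conjEpi h) (epiLagrangian g G x') ∩ Metric.ball (y, (p, k)) ε,
      ∀ q' ∈ saddleSet univ (conjEpi h) (epiLagrangian g G x') ∩ Metric.ball (y, (p, k)) ε,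
        q = q' := by
  have hgd : ∀ x, Differentiable ℝ (g x) := fun x =>
    (hg.comp (contDiff_prodMk_right x)).differentiable two_ne_zero
  have hGd : ∀ x, Differentiable ℝ (G x) := fun x =>
    (hG.comp (contDiff_prodMk_right x)).differentiable two_ne_zero
  have hGc : Continuous fun q : EuclideanSpace ℝ (Fin n) × EuclideanSpace ℝ (Fin m) ×
      EuclideanSpace ℝ (Fin s) => (G q.1 q.2.1, q.2.2) :=
    (hG.continuous.comp (by fun_prop : Continuous fun q : EuclideanSpace ℝ (Fin n) ×
      EuclideanSpace ℝ (Fin m) × EuclideanSpace ℝ (Fin s) => (q.1, q.2.1))).prodMk (by fun_prop)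
  have hsnd : Continuous fun q : EuclideanSpace ℝ (Fin n) × EuclideanSpace ℝ (Fin m) ×
      EuclideanSpace ℝ (Fin s) => q.2.2 := by fun_prop
  obtain ⟨ε₁, hε₁, h₁⟩ := Metric.eventually_nhds_iff.1
    ((hSOSC.eventually_primal_eq hproper hpoly hg hG hp hk).and
      (hSOSC.eventually_dual_eq hpoly hg hG hp))
  obtain ⟨ε₂, hε₂, h₂⟩ := Metric.eventually_nhds_iff.1
    (((hsnd.tendsto (x, y, p)).eventually (hpoly.eventually_mem_subdiff_of_nhds p)).and
      ((hGc.tendsto (x, y, p)).eventually (hpoly.eventually_mem_subdiff_left hp p)))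
  refine ⟨min ε₁ ε₂, lt_min hε₁ hε₂, ?_⟩
  filter_upwards [Metric.ball_mem_nhds x (lt_min hε₁ hε₂)] with x' hx'
  rintro ⟨y₁, p₁, r₁⟩ ⟨hq₁, hb₁⟩ ⟨y₂, p₂, r₂⟩ ⟨hq₂, hb₂⟩
  have hmem : ∀ {y p r}, (y, (p, r)) ∈ saddleSet univ (conjEpi h) (epiLagrangian g G x') →
      gradient (fun y' => g x' y' + inner ℝ (G x' y') p) y = 0 ∧ p ∈ subdiff h (G x' y) ∧
        conjugate h p = r := by
    intro y p r hq
    obtain ⟨hS, hr⟩ := (mem_S_iff_exists_mem_saddleSet hmono hproper (hg_conv x') (hG_conv x')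
      (hgd x') (hGd x')).2 hq
    rw [mem_S_iff (hgd x') (hGd x')] at hS
    exact ⟨hS.1, mem_subdiff_of_mem_subdiff_conjugate hproper hpoly.convex hpoly.isClosed hS.2, hr⟩
  -- Recombined saddle points reduce the comparison to one with a common multiplier and one with a
  -- common `y₁`.
  have hq₂₁ : (y₂, (p₁, r₁)) ∈ saddleSet univ (conjEpi h) (epiLagrangian g G x') :=
    ⟨mem_univ _, hq₁.2.1, hq₂.2.2.swap_left (mem_univ _) hq₂.2.1 hq₁.2.2⟩
  have hq₁₂ : (y₁, (p₂, r₂)) ∈ saddleSet univ (conjEpi h) (epiLagrangian g G x') :=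
    ⟨mem_univ _, hq₂.2.1, hq₁.2.2.swap_left (mem_univ _) hq₁.2.1 hq₂.2.2⟩
  have h11 := hmem hq₁
  have h21 := hmem hq₂₁
  have h12 := hmem hq₁₂
  simp only [Metric.mem_ball, Prod.dist_eq, max_lt_iff] at hb₁ hb₂ hx'
  have hnear : ∀ y' p', dist y' y < min ε₁ ε₂ → dist p' p < min ε₁ ε₂ →
      dist (x', y', p') (x, y, p) < min ε₁ ε₂ := by
    intro y' p' hy' hp'
    simp only [Prod.dist_eq, max_lt_iff]
    exact ⟨hx', hy', hp'⟩
  have d11 := hnear y₁ p₁ hb₁.1 hb₁.2.1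
  have d21 := hnear y₂ p₁ hb₂.1 hb₁.2.1
  have d12 := hnear y₁ p₂ hb₁.1 hb₂.2.1
  have hpair : ∀ {a b}, dist a (x, y, p) < min ε₁ ε₂ → dist b (x, y, p) < min ε₁ ε₂ →
      dist (a, b) ((x, y, p), (x, y, p)) < ε₁ := by
    intro a b ha hb
    rw [Prod.dist_eq]
    exact (max_lt ha hb).trans_le (min_le_left _ _)
  have e11 := h₂ (d11.trans_le (min_le_right _ _))
  have e12 := h₂ (d12.trans_le (min_le_right _ _))
  have hy : y₁ = y₂ := (h₁ (hpair d11 d21)).1 x' y₁ y₂ p₁ rfl (h11.1.trans h21.1.symm)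
    (vsub_mem_vectorSpan ℝ (e11.1 _ h11.2.1) (e11.1 _ h21.2.1))
  have hpp : p₁ = p₂ := (h₁ (hpair d11 d12)).2 x' y₁ p₁ p₂ rfl (h11.1.trans h12.1.symm)
    (vsub_mem_vectorSpan ℝ (e11.2 h11.2.1) (e12.2 h12.2.1))
  subst hy hpp
  have hr : r₁ = r₂ := by
    rw [← EReal.coe_eq_coe_iff, ← h11.2.2, ← h12.2.2]
  rw [hr]

end ExtendedNLP

end

/-! ### Conclusion -/

theorem theorem5 {n m s : ℕ}
    (g : EuclideanSpace ℝ (Fin n) → EuclideanSpace ℝ (Fin m) → ℝ)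
    (h : EuclideanSpace ℝ (Fin s) → EReal)
    (G : EuclideanSpace ℝ (Fin n) → EuclideanSpace ℝ (Fin m) → EuclideanSpace ℝ (Fin s))
    (hg : ContDiff ℝ 2 fun q : EuclideanSpace ℝ (Fin n) × EuclideanSpace ℝ (Fin m) => g q.1 q.2)
    (hG : ∀ i, ContDiff ℝ 2
      fun q : EuclideanSpace ℝ (Fin n) × EuclideanSpace ℝ (Fin m) => G q.1 q.2 i)
    (hg_conv : ∀ x, ConvexOn ℝ Set.univ (g x))
    (hG_conv : ∀ x i, ConvexOn ℝ Set.univ fun y => G x y i)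
    (h_proper : ExtendedNLP.Proper h)
    (h_poly : ExtendedNLP.EpiPolyhedral h)
    (h_mono : ExtendedNLP.Nondecreasing h)
    (x : EuclideanSpace ℝ (Fin n)) (y : EuclideanSpace ℝ (Fin m)) (p : EuclideanSpace ℝ (Fin s))
    (hBQ : ExtendedNLP.BasicQualification h G x y)
    (hS : (y, p) ∈ ExtendedNLP.S g h G x)
    (hSOSC : ExtendedNLP.SOSC g h G x y p) :
    ∀ᶠ x' in nhds x, ∃ q : EuclideanSpace ℝ (Fin m) × EuclideanSpace ℝ (Fin s),
      ExtendedNLP.S g h G x' = {q} := by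
  open ExtendedNLP in
  have hG' : ContDiff ℝ 2
      fun q : EuclideanSpace ℝ (Fin n) × EuclideanSpace ℝ (Fin m) => G q.1 q.2 :=
    contDiff_euclidean.2 hG
  have hgd : ∀ x, Differentiable ℝ (g x) := fun x =>
    (hg.comp (contDiff_prodMk_right x)).differentiable two_ne_zero
  have hGd : ∀ x, Differentiable ℝ (G x) := fun x =>
    (hG'.comp (contDiff_prodMk_right x)).differentiable two_ne_zero
  have hiff := fun x' (y' : EuclideanSpace ℝ (Fin m)) (p' : EuclideanSpace ℝ (Fin s)) (r : ℝ) =>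
    mem_S_iff_exists_mem_saddleSet h_mono h_proper (hg_conv x') (hG_conv x') (hgd x') (hGd x')
      (y := y') (p := p') (r := r)
  obtain ⟨k, hk, -⟩ := hS.2
  have hp : p ∈ subdiff h (G x y) :=
    mem_subdiff_of_mem_subdiff_conjugate h_proper h_poly.convex h_poly.isClosed hS.2
  obtain ⟨ε, hε, huniq⟩ := hSOSC.eventually_saddleSet_subsingleton hg hG' hg_conv hG_conv h_proper
    h_poly h_mono hp hk
  have hproj : Continuous fun q : EuclideanSpace ℝ (Fin n) × EuclideanSpace ℝ (Fin m) ×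
      EuclideanSpace ℝ (Fin s) × ℝ => (q.1, q.2.1) := by fun_prop
  have hcont : Continuous fun q : EuclideanSpace ℝ (Fin n) × EuclideanSpace ℝ (Fin m) ×
      EuclideanSpace ℝ (Fin s) × ℝ => epiLagrangian g G q.1 q.2.1 q.2.2 :=
    ((hg.continuous.comp hproj).add ((hG'.continuous.comp hproj).inner (by fun_prop))).sub
      (by fun_prop)
  filter_upwards [eventually_saddleSet_eq_singleton isClosed_conjEpi convex_conjEpi hcont
    (fun x' _ hP => convexOn_epiLagrangian h_mono h_proper (hg_conv x') (hG_conv x') hP)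
    (fun x' a => concaveOn_epiLagrangian x' a) ((hiff x y p k).1 ⟨hS, hk⟩) hε huniq] with x' hx'
  obtain ⟨⟨y', p', r'⟩, hq⟩ := hx'
  refine ⟨(y', p'), Set.eq_singleton_iff_unique_mem.2
    ⟨((hiff x' y' p' r').2 (hq ▸ Set.mem_singleton _)).1, ?_⟩⟩
  rintro ⟨y'', p''⟩ hmem
  -- A nonempty subdifferential makes `h*(p'')` finite, so every solution lifts to a saddle point.
  obtain ⟨r, hr, -⟩ := hmem.2
  have := (hiff x' y'' p'' r).1 ⟨hmem, hr⟩
  rw [hq, Set.mem_singleton_iff, Prod.mk.injEq, Prod.mk.injEq] at this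
  rw [this.1, this.2.1]
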